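/- For a Tychonoff space $X$ and a compact subset $K\subseteq X$, let $\operatorname{Homeo}_K(X)$ be the group of homeomorphisms of $X$ that are the identity on $X\setminus K$, equipped with the compact-open topology, and let $\operatorname{Homeo}_{cpt}(X)=\bigcup_K \operatorname{Homeo}_K(X)$, the union being over all compact subsets $K\subseteq X$. One says that $X$ has the Compactly Supported Homeomorphism Property (CSHP) if the following two topologies on $\operatorname{Homeo}_{cpt}(X)$ coincide: (1) the colimit topology, that is, the finest topology for which all inclusions $\operatorname{Homeo}_K(X)\to\operatorname{Homeo}_{cpt}(X)$ are continuous; (2) the topology induced by the homeomorphism group $\operatorname{Homeo}(\beta X)$ of the Stone–Čech compactification $\beta X$ with its compact-open topology, via the embedding that sends $f$ to its extension $\beta f$. Let $\omega_1$ be the first uncountable ordinal with the order topology, let the Closed Long Ray $\mathbb{L}_{\geq 0}$ be the product $\omega_1\times[0,1)$ with the order topology of the lexicographic order, and let the Long Line $\mathbb{L}$ be the quotient space obtained from the disjoint union of two copies of $\mathbb{L}_{\geq 0}$ by identifying their points $0=(0,0)$. Theorem. Let $C$ be a compact metrizable space. Then for all integers $n,m,l\geq 0$ the product space $$\mathbb{L}^n\times(\mathbb{L}_{\geq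 0})^m\times(\omega_1)^l\times C$$ is a Tychonoff space that has CSHP. -/

import Mathlib

open scoped Ordinal

/-! ### Topologies on groups of compactly supported homeomorphisms -/

/-- The compact-open topology on the group `Homeo(X)` of self-homeomorphisms of `X`. -/
@[reducible] def homeoCompactOpen (X : Type*) [TopologicalSpace X] : TopologicalSpace (X ≃ₜ X) :=
  TopologicalSpace.induced (fun f => (⟨f, f.continuous⟩ : C(X, X))) inferInstance

/-- `Homeo_K(X)`: the homeomorphisms of `X` that are the identity on `X \ K`. -/
def homeoOn {X : Type*} [TopologicalSpace X] (K : Set X) : Set (X ≃ₜ X) :=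
  {f | ∀ x, x ∉ K → f x = x}

/-- `Homeo_cpt(X)`: the union of the `Homeo_K(X)` over all compact subsets `K` of `X`. -/
def homeoCpt (X : Type*) [TopologicalSpace X] : Set (X ≃ₜ X) :=
  {f | ∃ K : Set X, IsCompact K ∧ f ∈ homeoOn K}

/-- The compact-open topology on `Homeo_K(X)`. -/
@[reducible] def homeoOnTopology {X : Type*} [TopologicalSpace X] (K : Set X) :
    TopologicalSpace (homeoOn K) :=
  TopologicalSpace.induced Subtype.val (homeoCompactOpen X)

/-- The inclusion of `Homeo_K(X)` into `Homeo_cpt(X)` for a compact subset `K` of `X`. -/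
def homeoOnInclusion {X : Type*} [TopologicalSpace X] (K : {K : Set X // IsCompact K})
    (f : homeoOn K.1) : homeoCpt X :=
  ⟨f.1, K.1, K.2, f.2⟩

/-- The colimit topology on `Homeo_cpt(X)`: the finest topology that makes the inclusion of
`Homeo_K(X)` continuous for every compact `K`. -/
@[reducible] def colimitTopology (X : Type*) [TopologicalSpace X] : TopologicalSpace (homeoCpt X) :=
  ⨆ K : {K : Set X // IsCompact K},
    TopologicalSpace.coinduced (homeoOnInclusion K) (homeoOnTopology K.1)

/-- The continuous extension to Stone-Čech compactifications of a continuous self-map. -/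
noncomputable def betaMap {X : Type*} [TopologicalSpace X] (f : C(X, X)) : C(StoneCech X, StoneCech X) :=
  ⟨stoneCechExtend (continuous_stoneCechUnit.comp f.continuous), continuous_stoneCechExtend _⟩

theorem betaMap_unit {X : Type*} [TopologicalSpace X] (f : C(X, X)) (x : X) :
    betaMap f (stoneCechUnit x) = stoneCechUnit (f x) :=
  stoneCechExtend_stoneCechUnit
    (continuous_stoneCechUnit.comp f.continuous) x

theorem betaMap_betaMap {X : Type*} [TopologicalSpace X] (f g : C(X, X))
    (h : ∀ x, f (g x) = x) (z : StoneCech X) : betaMap f (betaMap g z) = z := by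
  have := stoneCech_hom_ext ((betaMap f).continuous.comp (betaMap g).continuous)
    (continuous_id (X := StoneCech X)) (by funext x; simp [betaMap_unit, h])
  exact congrFun this z

/-- The homeomorphism of the Stone-Čech compactification that extends a homeomorphism of `X`. -/
noncomputable def betaHomeo {X : Type*} [TopologicalSpace X] (f : X ≃ₜ X) : StoneCech X ≃ₜ StoneCech X where
  toFun := betaMap ⟨f, f.continuous⟩
  invFun := betaMap ⟨f.symm, f.symm.continuous⟩
  left_inv := betaMap_betaMap _ _ f.symm_apply_apply
  right_inv := betaMap_betaMap _ _ f.apply_symm_apply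
  continuous_toFun := (betaMap _).continuous
  continuous_invFun := (betaMap _).continuous

/-- The topology on `Homeo_cpt(X)` that is induced by the homeomorphism group of the Stone-Čech
compactification of `X`, which carries the compact-open topology. -/
@[reducible] noncomputable def stoneCechTopology (X : Type*) [TopologicalSpace X] : TopologicalSpace (homeoCpt X) :=
  TopologicalSpace.induced (fun f => betaHomeo f.1) (homeoCompactOpen (StoneCech X))

/-- `X` is a Tychonoff space that has the Compactly Supported Homeomorphism Property: the two
topologies on `Homeo_cpt(X)` coincide. -/
structure HasCSHP (X : Type*) [TopologicalSpace X] : Prop where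
  tychonoff : T35Space X
  topology_eq : colimitTopology X = stoneCechTopology X

/-! ### `ω₁`, the Closed Long Ray and the Long Line -/

/-- The first uncountable ordinal, as the set of all smaller ordinals. -/
def OmegaOne : Type 1 := Set.Iio (ω₁ : Ordinal.{0})

noncomputable instance : LinearOrder OmegaOne :=
  inferInstanceAs (LinearOrder (Set.Iio (ω₁ : Ordinal.{0})))

/-- `ω₁` carries the order topology. -/
noncomputable instance : TopologicalSpace OmegaOne := Preorder.topology OmegaOne

instance : OrderTopology OmegaOne := ⟨rfl⟩

/-- The Closed Long Ray: `ω₁ × [0, 1)` with the lexicographic order. -/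
def ClosedLongRay : Type 1 := OmegaOne ×ₗ Set.Ico (0 : ℝ) 1

noncomputable instance : LinearOrder ClosedLongRay :=
  inferInstanceAs (LinearOrder (OmegaOne ×ₗ Set.Ico (0 : ℝ) 1))

/-- The Closed Long Ray carries the order topology. -/
noncomputable instance : TopologicalSpace ClosedLongRay := Preorder.topology ClosedLongRay

instance : OrderTopology ClosedLongRay := ⟨rfl⟩

/-- The boundary point `0 = (0, 0)` of the Closed Long Ray. -/
def ClosedLongRay.zero : ClosedLongRay :=
  toLex ((⟨0, Ordinal.omega_pos 1⟩ : Set.Iio (ω₁ : Ordinal.{0})),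
    (⟨0, le_rfl, zero_lt_one⟩ : Set.Ico (0 : ℝ) 1))

/-- The Long Line: two copies of the Closed Long Ray, glued together at their points `0`. -/
def LongLine : Type 1 :=
  Quot (fun x y : ClosedLongRay ⊕ ClosedLongRay =>
    x = Sum.inl ClosedLongRay.zero ∧ y = Sum.inr ClosedLongRay.zero)

/-- The Long Line carries the quotient topology. -/
instance : TopologicalSpace LongLine :=
  inferInstanceAs (TopologicalSpace (Quot (fun x y : ClosedLongRay ⊕ ClosedLongRay =>
    x = Sum.inl ClosedLongRay.zero ∧ y = Sum.inr ClosedLongRay.zero)))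

/-! The colimit topology is always the finer one: a homeomorphism supported in a compact `K` extends
to `βX` by the identity off `K`, so only its behaviour on `K` matters
(`colimitTopology_le_stoneCechTopology`).

The converse uses a `LongExhaustion`. Let `W` be open in the colimit topology but not a
neighbourhood of `f ∈ W` in the other one. Then for every stage `a` and every `k` some `g a k ∉ W`
is `1/(k+1)`-close to `f` after the retraction `retr a`, because that retraction extends to `βX`
(`eventually_stoneCech_lt`). Countable sets are bounded in `ω₁`, so there are stages `u 0 < u 1 <
...` with every `g (u n) k` supported in stage `u (n+1)`. With `c = sup u n`, all these maps live in
the one group of stage `c`. There `retr (u n)` tends to the identity, so `g (u n) k` tends to `f` as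
first `k` and then `n` goes to infinity (`eventually_retr_ne`). Hence some `g (u n) k` lies in `W`,
a contradiction.

Long exhaustions pass to finite products and to suitable closed subspaces. Truncation `min x (e a)`
provides them for `ω₁` and the closed ray, and the Long Line sits in the square of the ray as the
union of the two axes. -/

open Set Filter Topology

/-! ### Extensions to the Stone-Čech compactification -/

section StoneCech

variable {X : Type*} [TopologicalSpace X]

theorem betaHomeo_unit (f : X ≃ₜ X) (x : X) :
    betaHomeo f (stoneCechUnit x) = stoneCechUnit (f x) :=
  betaMap_unit _ x

theorem betaHomeo_eq_self_of_mem_closure {K : Set X} {f : X ≃ₜ X} (hf : f ∈ homeoOn K)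
    {z : StoneCech X} (hz : z ∈ closure (stoneCechUnit '' Kᶜ)) : betaHomeo f z = z := by
  refine closure_minimal ?_ (isClosed_eq (betaHomeo f).continuous continuous_id) hz
  rintro _ ⟨x, hx, rfl⟩
  simp [betaHomeo_unit, hf x hx]

/-- `X` is dense in `βX`, and the image of a compact set is already closed there. -/
theorem mem_image_or_mem_closure {K : Set X} (hK : IsCompact K) (z : StoneCech X) :
    z ∈ stoneCechUnit '' K ∨ z ∈ closure (stoneCechUnit '' Kᶜ) := by
  have hz : z ∈ closure (range (stoneCechUnit : X → StoneCech X)) := denseRange_stoneCechUnit z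
  rwa [← image_univ, ← union_compl_self K, image_union, closure_union,
    (hK.image continuous_stoneCechUnit).isClosed.closure_eq] at hz

theorem homeo_tendsto_iff {Y ι : Type*} [TopologicalSpace Y] {l : Filter ι} {F : ι → Y ≃ₜ Y}
    {f : Y ≃ₜ Y} : Tendsto F l (@nhds _ (homeoCompactOpen Y) f) ↔
      ∀ A, IsCompact A → ∀ U, IsOpen U → MapsTo f A U → ∀ᶠ i in l, MapsTo (F i) A U := by
  rw [nhds_induced, tendsto_comap_iff, ContinuousMap.tendsto_nhds_compactOpen]
  rfl

theorem homeoOn_tendsto_iff {ι : Type*} {K : Set X} {l : Filter ι} {F : ι → homeoOn K}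
    {f : homeoOn K} : Tendsto F l (@nhds _ (homeoOnTopology K) f) ↔
      ∀ A, IsCompact A → ∀ U, IsOpen U → MapsTo f.1 A U → ∀ᶠ i in l, MapsTo (F i).1 A U := by
  rw [← homeo_tendsto_iff, @nhds_induced _ _ (homeoCompactOpen X), tendsto_comap_iff]
  rfl

theorem stoneCech_tendsto_iff {ι : Type*} {l : Filter ι} {F : ι → homeoCpt X}
    {f : homeoCpt X} : Tendsto F l (@nhds _ (stoneCechTopology X) f) ↔
      ∀ A, IsCompact A → ∀ U, IsOpen U → MapsTo (betaHomeo f.1) A U →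
        ∀ᶠ i in l, MapsTo (betaHomeo (F i).1) A U := by
  rw [← homeo_tendsto_iff, @nhds_induced _ _ (homeoCompactOpen (StoneCech X)), tendsto_comap_iff]
  rfl

theorem colimitTopology_le_stoneCechTopology : colimitTopology X ≤ stoneCechTopology X := by
  refine iSup_le fun K => ?_
  rw [← continuous_iff_coinduced_le]
  let _ := homeoOnTopology K.1
  let _ := stoneCechTopology X
  refine continuous_iff_continuousAt.2 fun f => stoneCech_tendsto_iff.2 fun A hA U hU hf => ?_
  have hA' : IsCompact (K.1 ∩ stoneCechUnit ⁻¹' A) :=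
    K.2.inter_right (hA.isClosed.preimage continuous_stoneCechUnit)
  have := homeoOn_tendsto_iff.1 (tendsto_id (x := 𝓝 f)) _ hA' _
    (hU.preimage continuous_stoneCechUnit) (fun x hx => by
      have := hf hx.2
      rwa [betaHomeo_unit] at this)
  -- Off the image of `K` both extensions fix `z`, so control on `K ∩ A` suffices.
  filter_upwards [this] with g hg z hz
  rcases mem_image_or_mem_closure K.2 z with ⟨x, hx, rfl⟩ | h
  · rw [betaHomeo_unit (homeoOnInclusion K _).1]
    exact hg ⟨hx, hz⟩
  · have h1 := hf hz
    rwa [betaHomeo_eq_self_of_mem_closure (f := (homeoOnInclusion K _).1) f.2 h,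
      ← betaHomeo_eq_self_of_mem_closure (f := (homeoOnInclusion K _).1) g.2 h] at h1

/-- Homeomorphisms that are close to `f` in the topology induced from the Stone-Čech
compactification are uniformly close to `f` after a map `r` with compact range, as measured by a
continuous function `d` that vanishes on the diagonal. -/
theorem eventually_stoneCech_lt {r : X → X} (hr : Continuous r) (hc : IsCompact (range r))
    [T2Space X] {d : X × X → ℝ} (hd : Continuous d) (hd0 : ∀ x, d (x, x) = 0)
    (f : homeoCpt X) {ε : ℝ} (hε : 0 < ε) :
    ∀ᶠ g in @nhds _ (stoneCechTopology X) f, ∀ x, d (r (f.1 x), r (g.1 x)) < ε := by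
  have : CompactSpace (range r) := isCompact_iff_compactSpace.1 hc
  have hr' : Continuous (rangeFactorization r) := hr.subtype_mk _
  -- Compactness of the range is what lets `r` extend to `βX`.
  let R : StoneCech X → range r := stoneCechExtend hr'
  have hR : Continuous R := continuous_stoneCechExtend hr'
  have hRu : ∀ x, (R (stoneCechUnit x) : X) = r x := fun x =>
    congrArg Subtype.val (stoneCechExtend_stoneCechUnit hr' x)
  let _ := homeoCompactOpen (StoneCech X)
  have key : ∀ᶠ g in 𝓝 (betaHomeo f.1), ∀ z, d ((R (betaHomeo f.1 z) : X), (R (g z) : X)) < ε := by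
    have hev : Continuous fun p : (StoneCech X ≃ₜ StoneCech X) × StoneCech X => p.1 p.2 :=
      (continuous_eval (F := C(StoneCech X, StoneCech X))).comp
        ((continuous_induced_dom (f := fun g : StoneCech X ≃ₜ StoneCech X =>
          (⟨g, g.continuous⟩ : C(StoneCech X, StoneCech X)))).prodMap continuous_id)
    have hcont : Continuous fun p : (StoneCech X ≃ₜ StoneCech X) × StoneCech X =>
        d ((R (betaHomeo f.1 p.2) : X), (R (p.1 p.2) : X)) :=
      hd.comp ((continuous_subtype_val.comp
        (hR.comp ((betaHomeo f.1).continuous.comp continuous_snd))).prodMk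
          (continuous_subtype_val.comp (hR.comp hev)))
    let Φ : (StoneCech X ≃ₜ StoneCech X) → C(StoneCech X, ℝ) := fun g =>
      ⟨fun z => d ((R (betaHomeo f.1 z) : X), (R (g z) : X)),
        hcont.comp (Continuous.prodMk_right g)⟩
    -- Currying the jointly continuous distance, together with compactness of `βX`, makes the bound
    -- for all `z` at once an open condition on `g`.
    have hΦ : Continuous Φ := ContinuousMap.continuous_of_continuous_uncurry _ hcont
    have ho : IsOpen {h : C(StoneCech X, ℝ) | MapsTo h univ (Iio ε)} :=
      ContinuousMap.isOpen_setOfPred_mapsTo isCompact_univ isOpen_Iio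
    have : ∀ᶠ g in 𝓝 (betaHomeo f.1), Φ g ∈ {h : C(StoneCech X, ℝ) | MapsTo h univ (Iio ε)} := by
      refine hΦ.continuousAt.eventually_mem (ho.mem_nhds ?_)
      intro z _
      change d (_, _) < ε
      exact (hd0 _).trans_lt hε
    filter_upwards [this] with g hg z
    exact hg (mem_univ z)
  rw [@nhds_induced _ _ (homeoCompactOpen (StoneCech X))]
  refine (key.comap (fun g : homeoCpt X => betaHomeo g.1)).mono fun g hg x => ?_
  have := hg (stoneCechUnit x)
  rwa [betaHomeo_unit, betaHomeo_unit, hRu, hRu] at this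

end StoneCech

/-! ### Long exhaustions and the order of `ω₁` -/

/-- A long exhaustion of a space by compact metrizable retracts: a continuous `ω₁`-sequence of
retractions of `X` with increasing compact metrizable ranges that absorb every compact subset. -/
structure LongExhaustion (X : Type*) [TopologicalSpace X] where
  /-- the retractions -/
  retr : OmegaOne → X → X
  continuous_retr : ∀ a, Continuous (retr a)
  isCompact_range : ∀ a, IsCompact (range (retr a))
  retr_retr : ∀ {a b}, a ≤ b → ∀ x, retr b (retr a x) = retr a x
  exists_subset_range : ∀ K, IsCompact K → ∃ a, K ⊆ range (retr a)
  tendsto_retr : ∀ (u : ℕ → OmegaOne) (c : OmegaOne), Monotone u → IsLUB (range u) c → ∀ x,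
    Tendsto (fun p : ℕ × X => retr (u p.1) p.2) (atTop ×ˢ 𝓝 x) (𝓝 (retr c x))
  exists_separating : ∀ a, ∃ d : X × X → ℝ, Continuous d ∧ (∀ p, 0 ≤ d p) ∧ (∀ x, d (x, x) = 0) ∧
    ∀ x y, d (retr a x, retr a y) = 0 → retr a x = retr a y

instance : WellFoundedLT OmegaOne :=
  inferInstanceAs (WellFoundedLT (Set.Iio (ω₁ : Ordinal.{0})))

theorem OmegaOne.exists_forall_lt {ι : Type*} [Countable ι] (u : ι → OmegaOne) :
    ∃ b, ∀ i, u i < b := by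
  have hs : ∀ i, Order.succ (u i).1 < ω₁ := fun i =>
    (Cardinal.isSuccLimit_omega 1).succ_lt (u i).2
  refine ⟨(⟨⨆ i, Order.succ (u i).1, Ordinal.iSup_lt_omega_one hs⟩ : Set.Iio (ω₁ : Ordinal.{0})),
    fun i => ?_⟩
  have : (u i).1 < ⨆ i, Order.succ (u i).1 :=
    (Order.lt_succ _).trans_le (le_ciSup (f := fun i => Order.succ (u i).1)
      ⟨ω₁, by rintro _ ⟨i, rfl⟩; exact (hs i).le⟩ i)
  exact this

theorem OmegaOne.exists_isLUB {s : Set OmegaOne} (hs : BddAbove s) : ∃ c, IsLUB s c :=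
  ⟨_, (wellFounded_lt (α := OmegaOne)).min_mem _ hs,
    fun _ hx => (wellFounded_lt (α := OmegaOne)).min_le hx⟩

theorem OmegaOne.countable_Iic (a : OmegaOne) : (Iic a).Countable := by
  obtain ⟨b, hb⟩ := OmegaOne.exists_forall_lt (fun _ : Unit => a)
  have h : (Set.Iio b.1).Countable := by
    rw [← Cardinal.le_aleph0_iff_set_countable, Cardinal.mk_Iio_ordinal, Cardinal.lift_le_aleph0,
      ← Order.lt_succ_iff, Cardinal.succ_aleph0, ← Cardinal.lt_ord, Cardinal.ord_aleph]
    exact b.2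
  have := h.preimage (f := fun x : OmegaOne => x.1) Subtype.val_injective
  exact this.mono fun x hx => lt_of_le_of_lt (show x ≤ a from hx) (hb ())

/-! ### A long exhaustion implies CSHP -/

namespace LongExhaustion

variable {X : Type*} [TopologicalSpace X] (E : LongExhaustion X)

theorem mem_range_iff {a : OmegaOne} {x : X} : x ∈ range (E.retr a) ↔ E.retr a x = x :=
  ⟨by rintro ⟨y, rfl⟩; exact E.retr_retr le_rfl y, fun h => ⟨x, h⟩⟩

theorem range_mono {a b : OmegaOne} (h : a ≤ b) : range (E.retr a) ⊆ range (E.retr b) := by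
  rintro _ ⟨x, rfl⟩
  exact ⟨_, E.retr_retr h x⟩

theorem homeoOn_mono {K L : Set X} (h : K ⊆ L) : homeoOn K ⊆ homeoOn L :=
  fun _ hf x hx => hf x fun hK => hx (h hK)

theorem exists_mem_homeoOn (f : homeoCpt X) : ∃ a, f.1 ∈ homeoOn (range (E.retr a)) := by
  obtain ⟨K, hK, hf⟩ := f.2
  obtain ⟨a, ha⟩ := E.exists_subset_range K hK
  exact ⟨a, homeoOn_mono ha hf⟩

/-- If `f x` were outside `K`, it would be fixed, and injectivity would give `f x = x ∈ K`. -/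
theorem apply_mem_of_mem_homeoOn {K : Set X} {f : X ≃ₜ X} (hf : f ∈ homeoOn K) {x : X}
    (hx : x ∈ K) : f x ∈ K := by
  by_contra h
  exact h ((f.injective (hf _ h)).symm ▸ hx)

/-- Along a continuous sequence of retractions, disjoint compact subsets of the limit stage are
eventually kept apart. -/
theorem eventually_retr_ne [T2Space X] {u : ℕ → OmegaOne} {c : OmegaOne} (hu : Monotone u)
    (hc : IsLUB (range u) c) {A B : Set X} (hA : IsCompact A) (hB : IsCompact B)
    (hAc : A ⊆ range (E.retr c)) (hBc : B ⊆ range (E.retr c)) (hAB : Disjoint A B) :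
    ∀ᶠ n in atTop, ∀ x ∈ A, ∀ y ∈ B, E.retr (u n) x ≠ E.retr (u n) y := by
  -- Convergence of the retractions jointly in index and point makes the claim local on `A ×ˢ B`;
  -- compactness then yields one `n` for all pairs.
  have key : ∀ p ∈ A ×ˢ B, ∀ᶠ q : (X × X) × ℕ in 𝓝 p ×ˢ atTop,
      E.retr (u q.2) q.1.1 ≠ E.retr (u q.2) q.1.2 := by
    rintro ⟨x, y⟩ ⟨hx, hy⟩
    have hne : x ≠ y := fun h => disjoint_left.1 hAB hx (h ▸ hy)
    have h1 : Tendsto (fun q : (X × X) × ℕ => E.retr (u q.2) q.1.1) (𝓝 (x, y) ×ˢ atTop) (𝓝 x) := by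
      have := E.tendsto_retr u c hu hc x
      rw [E.mem_range_iff.1 (hAc hx)] at this
      exact this.comp (tendsto_snd.prodMk (continuous_fst.continuousAt.tendsto.comp tendsto_fst))
    have h2 : Tendsto (fun q : (X × X) × ℕ => E.retr (u q.2) q.1.2) (𝓝 (x, y) ×ˢ atTop) (𝓝 y) := by
      have := E.tendsto_retr u c hu hc y
      rw [E.mem_range_iff.1 (hBc hy)] at this
      exact this.comp (tendsto_snd.prodMk (continuous_snd.continuousAt.tendsto.comp tendsto_fst))
    exact (h1.prodMk_nhds h2).eventually
      ((isOpen_ne_fun continuous_fst continuous_snd).mem_nhds hne)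
  have : ∀ᶠ n in atTop, ∀ p ∈ A ×ˢ B, E.retr (u n) p.1 ≠ E.retr (u n) p.2 := by
    refine (hA.prod hB).induction_on (p := fun s => ∀ᶠ n in atTop, ∀ p ∈ s,
      E.retr (u n) p.1 ≠ E.retr (u n) p.2) (by simp) (fun s t hst h => h.mono fun n hn p hp =>
        hn p (hst hp)) (fun s t hs ht => ?_) (fun p hp => ?_)
    · filter_upwards [hs, ht] with n h1 h2 p hp
      exact hp.elim (h1 p) (h2 p)
    · obtain ⟨P, hP, Q, hQ, hPQ⟩ := Filter.eventually_prod_iff.1 (key p hp)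
      exact ⟨{x | P x}, mem_nhdsWithin_of_mem_nhds hP, hQ.mono fun n hn x hx => hPQ hx hn⟩
  exact this.mono fun n hn x hx y hy => hn (x, y) ⟨hx, hy⟩

theorem stoneCechTopology_le_colimitTopology [T2Space X] (E : LongExhaustion X) :
    stoneCechTopology X ≤ colimitTopology X := by
  intro W hW
  have hW' : ∀ a, IsOpen[homeoOnTopology (range (E.retr a))]
      (homeoOnInclusion ⟨_, E.isCompact_range a⟩ ⁻¹' W) := fun a =>
    isOpen_coinduced.1 (isOpen_iSup_iff.1 hW ⟨_, E.isCompact_range a⟩)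
  let _ := stoneCechTopology X
  refine isOpen_iff_mem_nhds.2 ?_
  intro f hf
  by_contra hnot
  choose d hdc hd0 hdd hds using E.exists_separating
  have hex : ∀ a (k : ℕ), ∃ g : homeoCpt X, (∀ x, d a (E.retr a (f.1 x), E.retr a (g.1 x)) <
      1 / ((k : ℝ) + 1)) ∧ g ∉ W := by
    intro a k
    by_contra! hcon
    exact hnot (mem_of_superset (eventually_stoneCech_lt (E.continuous_retr a)
      (E.isCompact_range a) (hdc a) (hdd a) f (Nat.one_div_pos_of_nat (n := k))) hcon)
  choose g hg hgW using hex
  choose b hb using fun a k => E.exists_mem_homeoOn (g a k)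
  obtain ⟨a₀, ha₀⟩ := E.exists_mem_homeoOn f
  -- `next a` lies beyond `a` (index `none`) and beyond the supports of all `g a k` (index `some
  -- k`).
  choose next hnext using fun a => OmegaOne.exists_forall_lt
    (fun k : Option ℕ => k.elim a (b a))
  let u : ℕ → OmegaOne := fun n => next^[n] a₀
  have hus : ∀ n, u (n + 1) = next (u n) := fun n => Function.iterate_succ_apply' _ _ _
  have hu : Monotone u := monotone_nat_of_le_succ fun n => by
    rw [hus]
    exact (hnext (u n) none).le
  obtain ⟨c, hc⟩ : ∃ c, IsLUB (range u) c := OmegaOne.exists_isLUB (by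
    obtain ⟨b, hb⟩ := OmegaOne.exists_forall_lt u
    exact ⟨b, by rintro _ ⟨n, rfl⟩; exact (hb n).le⟩)
  have hfc : f.1 ∈ homeoOn (range (E.retr c)) :=
    homeoOn_mono (E.range_mono (hc.1 ⟨0, rfl⟩)) ha₀
  have hgc : ∀ n k, (g (u n) k).1 ∈ homeoOn (range (E.retr c)) := fun n k =>
    homeoOn_mono (E.range_mono (((hnext (u n) (some k)).le.trans (hus n).ge).trans
      (hc.1 ⟨n + 1, rfl⟩))) (hb (u n) k)
  let F : ℕ × ℕ → homeoOn (range (E.retr c)) := fun p => ⟨(g (u p.1) p.2).1, hgc p.1 p.2⟩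
  -- An iterated limit: how large `k` must be depends on `n`.
  have hF : Tendsto F (curry atTop atTop)
      (@nhds _ (homeoOnTopology (range (E.retr c))) ⟨f.1, hfc⟩) := by
    refine homeoOn_tendsto_iff.2 fun A hA U hU hAU => ?_
    have hKc := E.isCompact_range c
    have h1 : IsCompact (f.1 '' (A ∩ range (E.retr c))) :=
      (hA.inter_right hKc.isClosed).image f.1.continuous
    have h2 : IsCompact (range (E.retr c) \ U) := hKc.diff hU
    have h3 := E.eventually_retr_ne hu hc h1 h2
      (by rintro _ ⟨x, hx, rfl⟩; exact apply_mem_of_mem_homeoOn hfc hx.2) sdiff_subset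
      (disjoint_left.2 (by rintro _ ⟨x, hx, rfl⟩ h; exact h.2 (hAU hx.1)))
    rw [eventually_curry_iff]
    filter_upwards [h3] with n hn
    -- `retr (u n)` keeps these two compact sets apart, so the separating function has a positive
    -- lower bound on their product.
    obtain ⟨η, hη, hlt⟩ : ∃ η > 0, ∀ p ∈ (f.1 '' (A ∩ range (E.retr c))) ×ˢ
        (range (E.retr c) \ U), η ≤ d (u n) (E.retr (u n) p.1, E.retr (u n) p.2) := by
      refine (h1.prod h2).exists_forall_le' (a := 0) (Continuous.continuousOn ?_) ?_
      · exact (hdc _).comp (((E.continuous_retr _).comp continuous_fst).prodMk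
          ((E.continuous_retr _).comp continuous_snd))
      · rintro p ⟨hp1, hp2⟩
        exact (hd0 _ _).lt_of_ne fun h => hn _ hp1 _ hp2 (hds _ _ _ h.symm)
    filter_upwards [tendsto_one_div_add_atTop_nhds_zero_nat.eventually_lt_const hη] with k hk x hx
    by_contra hxU
    by_cases hxc : x ∈ range (E.retr c)
    · exact (hlt (f.1 x, (F (n, k)).1 x) ⟨⟨x, ⟨hx, hxc⟩, rfl⟩,
        apply_mem_of_mem_homeoOn (F (n, k)).2 hxc, hxU⟩).not_gt ((hg (u n) k x).trans hk)
    · refine hxU ?_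
      rw [(F (n, k)).2 x hxc, ← hfc x hxc]
      exact hAU hx
  let _ := homeoOnTopology (range (E.retr c))
  have hmem := hF.eventually ((hW' c).mem_nhds hf)
  obtain ⟨n, hn⟩ := (eventually_curry_iff.1 hmem).exists
  obtain ⟨k, h⟩ := hn.exists
  exact hgW (u n) k h

theorem hasCSHP [T35Space X] (E : LongExhaustion X) : HasCSHP X :=
  ⟨inferInstance, le_antisymm colimitTopology_le_stoneCechTopology
    E.stoneCechTopology_le_colimitTopology⟩

end LongExhaustion

/-! ### Constructions of long exhaustions -/

namespace LongExhaustion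

section Constructions

variable {X Y : Type*} [TopologicalSpace X] [TopologicalSpace Y]

theorem exists_separating_of_metrizable {r : X → X} (hr : Continuous r)
    (hrr : ∀ x, r (r x) = r x) [TopologicalSpace.MetrizableSpace (range r)] :
    ∃ d : X × X → ℝ, Continuous d ∧ (∀ p, 0 ≤ d p) ∧ (∀ x, d (x, x) = 0) ∧
      ∀ x y, d (r x, r y) = 0 → r x = r y := by
  let _ := TopologicalSpace.metrizableSpaceMetric (range r)
  have hr' : Continuous (rangeFactorization r) := hr.subtype_mk _
  refine ⟨fun p => dist (rangeFactorization r p.1) (rangeFactorization r p.2),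
    (hr'.comp continuous_fst).dist (hr'.comp continuous_snd), fun _ => dist_nonneg,
    fun _ => dist_self _, fun x y h => ?_⟩
  have := congrArg Subtype.val (dist_eq_zero.1 h)
  simpa [rangeFactorization, hrr] using this

/-- A compact metrizable space is exhausted by itself. -/
def ofCompact (X : Type*) [TopologicalSpace X] [CompactSpace X]
    [TopologicalSpace.MetrizableSpace X] : LongExhaustion X where
  retr _ := id
  continuous_retr _ := continuous_id
  isCompact_range _ := by simpa using isCompact_univ
  retr_retr _ _ := rfl
  exists_subset_range _ _ :=
    ⟨(⟨0, Ordinal.omega_pos 1⟩ : Set.Iio (ω₁ : Ordinal.{0})), by simp⟩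
  tendsto_retr _ _ _ _ _ := tendsto_snd
  exists_separating _ := exists_separating_of_metrizable continuous_id fun _ => rfl

/-- The product of two long exhaustions. -/
def prod (E : LongExhaustion X) (F : LongExhaustion Y) : LongExhaustion (X × Y) where
  retr a := Prod.map (E.retr a) (F.retr a)
  continuous_retr a := (E.continuous_retr a).prodMap (F.continuous_retr a)
  isCompact_range a := by
    rw [range_prodMap]
    exact (E.isCompact_range a).prod (F.isCompact_range a)
  retr_retr h x := Prod.ext (E.retr_retr h _) (F.retr_retr h _)
  exists_subset_range K hK := by
    obtain ⟨a, ha⟩ := E.exists_subset_range _ (hK.image continuous_fst)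
    obtain ⟨b, hb⟩ := F.exists_subset_range _ (hK.image continuous_snd)
    refine ⟨max a b, fun p hp => ?_⟩
    rw [range_prodMap]
    exact ⟨E.range_mono (le_max_left a b) (ha ⟨p, hp, rfl⟩),
      F.range_mono (le_max_right a b) (hb ⟨p, hp, rfl⟩)⟩
  tendsto_retr u c hu hc x := by
    refine Tendsto.prodMk_nhds ?_ ?_
    · exact (E.tendsto_retr u c hu hc x.1).comp
        (tendsto_fst.prodMk (continuous_fst.continuousAt.tendsto.comp tendsto_snd))
    · exact (F.tendsto_retr u c hu hc x.2).comp
        (tendsto_fst.prodMk (continuous_snd.continuousAt.tendsto.comp tendsto_snd))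
  exists_separating a := by
    obtain ⟨d, hc, h0, hd, hs⟩ := E.exists_separating a
    obtain ⟨d', hc', h0', hd', hs'⟩ := F.exists_separating a
    refine ⟨fun p => d (p.1.1, p.2.1) + d' (p.1.2, p.2.2), by fun_prop,
      fun p => add_nonneg (h0 _) (h0' _), fun x => by simp [hd, hd'], fun x y h => ?_⟩
    have := (add_eq_zero_iff_of_nonneg (h0 _) (h0' _)).1 h
    exact Prod.ext (hs _ _ this.1) (hs' _ _ this.2)

/-- A finite power of a long exhaustion. -/
def pi (ι : Type*) [Fintype ι] (E : LongExhaustion X) : LongExhaustion (ι → X) where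
  retr a := Pi.map fun _ => E.retr a
  continuous_retr a := Continuous.piMap fun _ => E.continuous_retr a
  isCompact_range a := by
    rw [range_piMap]
    exact isCompact_univ_pi fun _ => E.isCompact_range a
  retr_retr h x := funext fun i => E.retr_retr h (x i)
  exists_subset_range K hK := by
    choose a ha using fun i : ι => E.exists_subset_range _ (hK.image (continuous_apply i))
    obtain ⟨b, hb⟩ := OmegaOne.exists_forall_lt a
    refine ⟨b, fun x hx => ?_⟩
    rw [range_piMap]
    exact fun i _ => E.range_mono (hb i).le (ha i ⟨x, hx, rfl⟩)
  tendsto_retr u c hu hc x := tendsto_pi_nhds.2 fun i =>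
    (E.tendsto_retr u c hu hc (x i)).comp
      (tendsto_fst.prodMk ((continuous_apply i).continuousAt.tendsto.comp tendsto_snd))
  exists_separating a := by
    obtain ⟨d, hc, h0, hd, hs⟩ := E.exists_separating a
    refine ⟨fun p => ∑ i, d (p.1 i, p.2 i), by fun_prop,
      fun p => Finset.sum_nonneg fun i _ => h0 _, fun x => by simp [hd], fun x y h => ?_⟩
    have := (Finset.sum_eq_zero_iff_of_nonneg fun i _ => h0 _).1 h
    exact funext fun i => hs _ _ (this i (Finset.mem_univ i))

/-- A long exhaustion restricts to a closed subspace that its retractions preserve. -/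
noncomputable def ofIsClosedEmbedding (E : LongExhaustion X) {j : Y → X} (hj : IsClosedEmbedding j)
    {s : OmegaOne → Y → Y} (hs : ∀ a y, j (s a y) = E.retr a (j y)) : LongExhaustion Y where
  retr := s
  continuous_retr a := by
    rw [hj.isInducing.continuous_iff]
    exact ((E.continuous_retr a).comp hj.continuous).congr fun y => (hs a y).symm
  isCompact_range a := by
    have : range (s a) = j ⁻¹' range (E.retr a) := by
      ext y
      constructor
      · rintro ⟨y, rfl⟩
        exact ⟨j y, (hs a y).symm⟩
      · intro hy
        exact ⟨y, hj.injective ((hs a y).trans (E.mem_range_iff.1 hy))⟩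
    rw [this]
    exact hj.isCompact_preimage (E.isCompact_range a)
  retr_retr h x := hj.injective (by simp [hs, E.retr_retr h])
  exists_subset_range K hK := by
    obtain ⟨a, ha⟩ := E.exists_subset_range _ (hK.image hj.continuous)
    exact ⟨a, fun y hy =>
      ⟨y, hj.injective ((hs a y).trans (E.mem_range_iff.1 (ha ⟨y, hy, rfl⟩)))⟩⟩
  tendsto_retr u c hu hc x := by
    rw [hj.isInducing.tendsto_nhds_iff, hs]
    exact ((E.tendsto_retr u c hu hc (j x)).comp (tendsto_fst.prodMk
      (hj.continuous.continuousAt.tendsto.comp tendsto_snd))).congr fun p => (hs _ _).symm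
  exists_separating a := by
    obtain ⟨d, hc, h0, hd, hds⟩ := E.exists_separating a
    refine ⟨fun p => d (j p.1, j p.2),
      hc.comp (hj.continuous.prodMap hj.continuous), fun p => h0 _, fun x => hd _,
      fun x y h => hj.injective ?_⟩
    simp only [hs] at h ⊢
    exact hds _ _ h

end Constructions

end LongExhaustion

/-! ### Long exhaustions of linear orders -/

section LinearOrder

variable {α : Type*} [LinearOrder α] [TopologicalSpace α] [OrderTopology α]

theorem isCompact_Icc_of_exists_isLUB
    (h : ∀ s : Set α, s.Nonempty → BddAbove s → ∃ c, IsLUB s c) (a b : α) :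
    IsCompact (Icc a b) := by
  classical
  have h' : ∀ s : Set α, s.Nonempty → BddBelow s → ∃ c, IsGLB s c := fun s hn hb =>
    (h (lowerBounds s) hb hn.bddAbove_lowerBounds).imp fun _ => isLUB_lowerBounds.1
  let _ : ConditionallyCompleteLinearOrder α :=
    { ‹LinearOrder α›, LinearOrder.toLattice (α := α) with
      -- The default `a` serves both empty and unbounded sets, as the last two fields require.
      sSup := fun s => if hs : s.Nonempty ∧ BddAbove s then (h s hs.1 hs.2).choose else a
      sInf := fun s => if hs : s.Nonempty ∧ BddBelow s then (h' s hs.1 hs.2).choose else a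
      isLUB_csSup := fun s hn hb => by
        rw [dif_pos ⟨hn, hb⟩]
        exact (h s hn hb).choose_spec
      isGLB_csInf := fun s hn hb => by
        rw [dif_pos ⟨hn, hb⟩]
        exact (h' s hn hb).choose_spec
      csSup_of_not_bddAbove := fun s hs => by
        rw [dif_neg fun h => hs h.2, dif_neg (by simp)]
      csInf_of_not_bddBelow := fun s hs => by
        rw [dif_neg fun h => hs h.2, dif_neg (by simp)] }
  exact isCompact_Icc

/-- Every open ray is a union of rays with endpoints in `D`. The weak inequalities allow for jumps,
as in `ω₁`. -/
theorem secondCountableTopology_of_countable_separating {D : Set α} (hD : D.Countable)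
    (h : ∀ x y, x < y → (∃ d ∈ D, x ≤ d ∧ d < y) ∧ ∃ d ∈ D, x < d ∧ d ≤ y) :
    SecondCountableTopology α := by
  refine ⟨Ioi '' D ∪ Iio '' D, (hD.image _).union (hD.image _), le_antisymm ?_ ?_⟩
  · refine le_generateFrom ?_
    rintro _ (⟨d, -, rfl⟩ | ⟨d, -, rfl⟩)
    exacts [isOpen_Ioi, isOpen_Iio]
  · refine (le_generateFrom ?_).trans_eq (OrderTopology.topology_eq_generate_intervals (α := α)).symm
    let t := TopologicalSpace.generateFrom (Ioi '' D ∪ Iio '' D)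
    rintro _ ⟨a, rfl | rfl⟩
    · have : Ioi a = ⋃ d ∈ D ∩ Ici a, Ioi d := by
        ext y
        simp only [mem_iUnion, mem_Ioi]
        constructor
        · intro hy
          obtain ⟨d, hd, h1, h2⟩ := (h a y hy).1
          exact ⟨d, ⟨hd, h1⟩, h2⟩
        · rintro ⟨d, hd, h⟩
          exact lt_of_le_of_lt hd.2 h
      rw [this]
      exact @isOpen_biUnion _ _ t _ _ fun d hd =>
        TopologicalSpace.isOpen_generateFrom_of_mem (Or.inl ⟨d, hd.1, rfl⟩)
    · have : Iio a = ⋃ d ∈ D ∩ Iic a, Iio d := by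
        ext y
        simp only [mem_iUnion, mem_Iio]
        constructor
        · intro hy
          obtain ⟨d, hd, h1, h2⟩ := (h y a hy).2
          exact ⟨d, ⟨hd, h2⟩, h1⟩
        · rintro ⟨d, hd, h⟩
          exact lt_of_lt_of_le h hd.2
      rw [this]
      exact @isOpen_biUnion _ _ t _ _ fun d hd =>
        TopologicalSpace.isOpen_generateFrom_of_mem (Or.inr ⟨d, hd.1, rfl⟩)

/-- The long exhaustion of a linear order by the initial segments below a cofinal continuous
`ω₁`-sequence. -/
noncomputable def LongExhaustion.ofLinearOrder {b : α} (hb : IsBot b)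
    (hsup : ∀ s : Set α, s.Nonempty → BddAbove s → ∃ c, IsLUB s c)
    {e : OmegaOne → α} (he : Monotone e) (hcof : ∀ x, ∃ a, x ≤ e a)
    (hlub : ∀ (u : ℕ → OmegaOne) c, IsLUB (range u) c → IsLUB (range (e ∘ u)) (e c))
    (hsep : ∀ a, ∃ D : Set α, D.Countable ∧ ∀ x y, x < y → y ≤ e a →
      (∃ d ∈ D, x ≤ d ∧ d < y) ∧ ∃ d ∈ D, x < d ∧ d ≤ y) : LongExhaustion α where
  retr a x := min x (e a)
  continuous_retr a := continuous_id.min continuous_const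
  isCompact_range a := by
    have : range (fun x => min x (e a)) = Icc b (e a) := by
      ext y
      exact ⟨by rintro ⟨x, rfl⟩; exact ⟨hb _, min_le_right _ _⟩, fun h => ⟨y, min_eq_left h.2⟩⟩
    rw [this]
    exact isCompact_Icc_of_exists_isLUB hsup _ _
  retr_retr h x := min_eq_left ((min_le_right _ _).trans (he h))
  exists_subset_range K hK := by
    have : Nonempty α := ⟨b⟩
    obtain ⟨x, hx⟩ := hK.bddAbove
    obtain ⟨a, ha⟩ := hcof x
    exact ⟨a, fun y hy => ⟨y, min_eq_left ((hx hy).trans ha)⟩⟩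
  tendsto_retr u c hu hc x :=
    tendsto_snd.min ((tendsto_atTop_isLUB (he.comp hu) (hlub u c hc)).comp tendsto_fst)
  exists_separating a := by
    have hr : range (fun x => min x (e a)) = Iic (e a) := by
      ext y
      exact ⟨by rintro ⟨x, rfl⟩; exact min_le_right _ _, fun h => ⟨y, min_eq_left h⟩⟩
    obtain ⟨D, hD, h⟩ := hsep a
    -- Second countability gives metrizability by Urysohn's theorem.
    have : SecondCountableTopology (Iic (e a)) :=
      secondCountableTopology_of_countable_separating
        (hD.preimage (f := ((↑) : Iic (e a) → α)) Subtype.val_injective) fun x y hxy => by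
          obtain ⟨⟨d, hd, h1, h2⟩, d', hd', h1', h2'⟩ := h x y hxy y.2
          exact ⟨⟨⟨d, h2.le.trans y.2⟩, hd, h1, h2⟩, ⟨d', h2'.trans y.2⟩, hd', h1', h2'⟩
    have : TopologicalSpace.MetrizableSpace (range fun x => min x (e a)) := by
      rw [hr]
      infer_instance
    exact exists_separating_of_metrizable (continuous_id.min continuous_const) fun x => by simp

end LinearOrder

/-- The long exhaustion of `ω₁`. -/
noncomputable def OmegaOne.longExhaustion : LongExhaustion OmegaOne :=
  .ofLinearOrder (b := (⟨0, Ordinal.omega_pos 1⟩ : Set.Iio (ω₁ : Ordinal.{0})))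
    (e := id) (fun x => show (0 : Ordinal) ≤ x.1 from zero_le) (fun _ _ => OmegaOne.exists_isLUB)
    monotone_id (fun x => ⟨x, le_rfl⟩) (fun _ _ h => h) fun a =>
      ⟨Iic a, OmegaOne.countable_Iic a, fun x y hxy hy =>
        ⟨⟨x, hxy.le.trans hy, le_rfl, hxy⟩, y, hy, hxy, le_rfl⟩⟩

/-! ### The Closed Long Ray -/

namespace ClosedLongRay

/-- The point `(a, t)` of the Closed Long Ray. -/
def mk (a : OmegaOne) (t : Ico (0 : ℝ) 1) : ClosedLongRay := toLex (a, t)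

theorem exists_eq_mk (x : ClosedLongRay) : ∃ a t, x = mk a t := ⟨_, _, rfl⟩

theorem mk_le_mk {a b : OmegaOne} {s t : Ico (0 : ℝ) 1} :
    mk a s ≤ mk b t ↔ a < b ∨ a = b ∧ s ≤ t :=
  Prod.Lex.toLex_le_toLex (x := (a, s)) (y := (b, t))

theorem mk_lt_mk {a b : OmegaOne} {s t : Ico (0 : ℝ) 1} :
    mk a s < mk b t ↔ a < b ∨ a = b ∧ s < t :=
  Prod.Lex.toLex_lt_toLex (x := (a, s)) (y := (b, t))

theorem zero_le (x : ClosedLongRay) : zero ≤ x := by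
  obtain ⟨a, t, rfl⟩ := exists_eq_mk x
  have h : (⟨0, Ordinal.omega_pos 1⟩ : Set.Iio (ω₁ : Ordinal.{0})) ≤ a :=
    show (0 : Ordinal) ≤ a.1 from _root_.zero_le
  refine mk_le_mk.2 ?_
  rcases h.lt_or_eq with h | h
  · exact Or.inl h
  · exact Or.inr ⟨h, t.2.1⟩

/-- The point `(a, 0)` of the Closed Long Ray. -/
def ofOmegaOne (a : OmegaOne) : ClosedLongRay := mk a ⟨0, le_rfl, zero_lt_one⟩

theorem ofOmegaOne_le_mk {a b : OmegaOne} {t : Ico (0 : ℝ) 1} :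
    ofOmegaOne a ≤ mk b t ↔ a ≤ b := by
  refine mk_le_mk.trans ⟨fun h => h.elim le_of_lt fun h => h.1.le, fun h => ?_⟩
  exact h.lt_or_eq.imp id fun h => ⟨h, t.2.1⟩

theorem mk_lt_ofOmegaOne {a b : OmegaOne} {t : Ico (0 : ℝ) 1} :
    mk a t < ofOmegaOne b ↔ a < b := by
  rw [← not_le, ofOmegaOne_le_mk, not_le]

theorem exists_lt_ofOmegaOne (x : ClosedLongRay) : ∃ a, x < ofOmegaOne a := by
  obtain ⟨a, t, rfl⟩ := exists_eq_mk x
  obtain ⟨b, hb⟩ := OmegaOne.exists_forall_lt (fun _ : Unit => a)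
  exact ⟨b, mk_lt_ofOmegaOne.2 (hb ())⟩

theorem exists_isLUB {s : Set ClosedLongRay} (hb : BddAbove s) :
    ∃ c, IsLUB s c := by
  have hne : {a | ofOmegaOne a ∈ upperBounds s}.Nonempty := by
    obtain ⟨x, hx⟩ := hb
    obtain ⟨a, ha⟩ := exists_lt_ofOmegaOne x
    exact ⟨a, fun y hy => (hx hy).trans ha.le⟩
  -- If the least upper bound of the form `(c, 0)` is not the supremum, then by minimality of `c`
  -- the set meets the fibre of a smaller upper bound `(b, r)`, and a real supremum in that fibre
  -- does it; it is below `1` because `r` is.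
  obtain ⟨c, hc, hmin⟩ := wellFounded_lt.has_min _ hne
  by_cases hlub : IsLUB s (ofOmegaOne c)
  · exact ⟨_, hlub⟩
  obtain ⟨y, hy, hyc⟩ : ∃ y ∈ upperBounds s, y < ofOmegaOne c := by
    by_contra! h
    exact hlub ⟨hc, h⟩
  obtain ⟨b, r, rfl⟩ := exists_eq_mk y
  have hbc : b < c := mk_lt_ofOmegaOne.1 hyc
  obtain ⟨z, hz, hbz⟩ : ∃ z ∈ s, ofOmegaOne b < z := by
    by_contra! h
    exact hmin b h hbc
  obtain ⟨b', t₀, rfl⟩ := exists_eq_mk z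
  obtain rfl : b = b' := by
    refine le_antisymm (ofOmegaOne_le_mk.1 hbz.le) ?_
    rcases mk_le_mk.1 (hy hz) with h | h
    exacts [h.le, h.1.le]
  let T : Set ℝ := {t | ∃ h : t ∈ Ico (0 : ℝ) 1, mk b ⟨t, h⟩ ∈ s}
  have hT : T.Nonempty := ⟨t₀, t₀.2, hz⟩
  have hTr : ∀ t ∈ T, t ≤ r := by
    rintro t ⟨h, ht⟩
    rcases mk_le_mk.1 (hy ht) with h | h
    exacts [absurd h (lt_irrefl _), h.2]
  have hTb : BddAbove T := ⟨r, hTr⟩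
  have hmem : sSup T ∈ Ico (0 : ℝ) 1 :=
    ⟨t₀.2.1.trans (le_csSup hTb ⟨t₀.2, hz⟩), (csSup_le hT hTr).trans_lt r.2.2⟩
  refine ⟨mk b ⟨sSup T, hmem⟩, fun x hx => ?_, fun x hx => ?_⟩
  · obtain ⟨a, t, rfl⟩ := exists_eq_mk x
    refine mk_le_mk.2 ((mk_le_mk.1 (hy hx)).imp id ?_)
    rintro ⟨rfl, -⟩
    exact ⟨rfl, le_csSup hTb ⟨t.2, hx⟩⟩
  · obtain ⟨a, t, rfl⟩ := exists_eq_mk x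
    refine mk_le_mk.2 ((mk_le_mk.1 (hx hz)).imp id ?_)
    rintro ⟨rfl, -⟩
    refine ⟨rfl, csSup_le hT ?_⟩
    rintro q ⟨h, hq⟩
    rcases mk_le_mk.1 (hx hq) with h | h
    exacts [absurd h (lt_irrefl _), h.2]

theorem exists_countable_separating (a : OmegaOne) : ∃ D : Set ClosedLongRay, D.Countable ∧
    ∀ x y, x < y → y ≤ ofOmegaOne a →
      (∃ d ∈ D, x ≤ d ∧ d < y) ∧ ∃ d ∈ D, x < d ∧ d ≤ y := by
  have hQ : {t : Ico (0 : ℝ) 1 | ∃ q : ℚ, (q : ℝ) = t}.Countable :=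
    (countable_range ((↑) : ℚ → ℝ)).preimage (f := ((↑) : Ico (0 : ℝ) 1 → ℝ)) Subtype.val_injective
  -- `D` consists of the points with first coordinate at most `a` and rational second coordinate.
  refine ⟨(fun p : OmegaOne × Ico (0 : ℝ) 1 => mk p.1 p.2) '' (Iic a ×ˢ _),
    ((OmegaOne.countable_Iic a).prod hQ).image _, fun x y hxy hya => ?_⟩
  obtain ⟨b, s, rfl⟩ := exists_eq_mk x
  obtain ⟨c, t, rfl⟩ := exists_eq_mk y
  have hca : c ≤ a := by
    rcases mk_le_mk.1 hya with h | h
    exacts [h.le, h.1.le]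
  rcases mk_lt_mk.1 hxy with h | ⟨rfl, h⟩
  · obtain ⟨q, hq, hq1⟩ := exists_rat_btwn s.2.2
    exact ⟨⟨_, ⟨(b, ⟨q, s.2.1.trans hq.le, hq1⟩), ⟨h.le.trans hca, q, rfl⟩, rfl⟩,
      mk_le_mk.2 (Or.inr ⟨rfl, hq.le⟩), mk_lt_mk.2 (Or.inl h)⟩,
      ofOmegaOne c, ⟨(c, ⟨0, le_rfl, zero_lt_one⟩), ⟨hca, 0, by simp⟩, rfl⟩,
      mk_lt_ofOmegaOne.2 h, ofOmegaOne_le_mk.2 le_rfl⟩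
  · obtain ⟨q, hq, hq1⟩ := exists_rat_btwn (show (s : ℝ) < t from h)
    have hmem : mk b ⟨q, s.2.1.trans hq.le, hq1.trans t.2.2⟩ ∈
        (fun p : OmegaOne × Ico (0 : ℝ) 1 => mk p.1 p.2) ''
          (Iic a ×ˢ {t : Ico (0 : ℝ) 1 | ∃ q : ℚ, (q : ℝ) = t}) :=
      ⟨(b, ⟨q, _⟩), ⟨hca, q, rfl⟩, rfl⟩
    exact ⟨⟨_, hmem, mk_le_mk.2 (Or.inr ⟨rfl, hq.le⟩), mk_lt_mk.2 (Or.inr ⟨rfl, hq1⟩)⟩,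
      _, hmem, mk_lt_mk.2 (Or.inr ⟨rfl, hq⟩), mk_le_mk.2 (Or.inr ⟨rfl, hq1.le⟩)⟩

/-- The long exhaustion of the Closed Long Ray by the intervals from `0` to `(a, 0)`. -/
noncomputable def longExhaustion : LongExhaustion ClosedLongRay :=
  .ofLinearOrder (e := ofOmegaOne) zero_le (fun _ _ => exists_isLUB)
    (fun _ _ h => ofOmegaOne_le_mk.2 h)
    (fun x => (exists_lt_ofOmegaOne x).imp fun _ h => h.le)
    -- Whether `(b, t)` bounds points `(a, 0)` depends only on `b`, so suprema are preserved.
    (fun u c hc => by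
      refine ⟨?_, fun x hx => ?_⟩
      · rintro _ ⟨n, rfl⟩
        exact ofOmegaOne_le_mk.2 (hc.1 ⟨n, rfl⟩)
      · obtain ⟨b, t, rfl⟩ := exists_eq_mk x
        refine ofOmegaOne_le_mk.2 (hc.2 ?_)
        rintro _ ⟨n, rfl⟩
        exact ofOmegaOne_le_mk.1 (hx ⟨n, rfl⟩))
    exists_countable_separating

end ClosedLongRay

/-! ### The Long Line as a pair of axes -/

namespace LongLine

open ClosedLongRay

/-- The coordinates of a point of the Long Line on the two half lines. -/
def toProd : LongLine → ClosedLongRay × ClosedLongRay :=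
  Quot.lift (Sum.elim (fun x => (x, zero)) fun x => (zero, x)) (by
    rintro _ _ ⟨rfl, rfl⟩
    rfl)

theorem toProd_injective : Function.Injective toProd := by
  have h : Quot.mk _ (Sum.inl zero) = (Quot.mk _ (Sum.inr zero) : LongLine) :=
    Quot.sound ⟨rfl, rfl⟩
  rintro ⟨x | x⟩ ⟨y | y⟩ hxy
  · obtain rfl : x = y := congrArg Prod.fst hxy
    rfl
  · obtain rfl : x = zero := congrArg Prod.fst hxy
    obtain rfl : zero = y := congrArg Prod.snd hxy
    exact h
  · obtain rfl : zero = y := congrArg Prod.fst hxy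
    obtain rfl : x = zero := congrArg Prod.snd hxy
    exact h.symm
  · obtain rfl : x = y := congrArg Prod.snd hxy
    rfl

theorem isClosedEmbedding_toProd : IsClosedEmbedding toProd := by
  have hl : Continuous fun x : ClosedLongRay => (x, zero) := by fun_prop
  have hr : Continuous fun x : ClosedLongRay => (zero, x) := by fun_prop
  refine .of_continuous_injective_isClosedMap (continuous_quot_lift _ (hl.sumElim hr))
    toProd_injective fun F hF => ?_
  have hF' : IsClosed (Quot.mk _ ⁻¹' F : Set (ClosedLongRay ⊕ ClosedLongRay)) :=
    hF.preimage continuous_quot_mk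
  -- The image is the union of its traces on the two axes, each closed.
  have : toProd '' F = (Prod.fst ⁻¹' ((fun x => Quot.mk _ (Sum.inl x)) ⁻¹' F) ∩
      Prod.snd ⁻¹' {zero}) ∪ (Prod.snd ⁻¹' ((fun x => Quot.mk _ (Sum.inr x)) ⁻¹' F) ∩
      Prod.fst ⁻¹' {zero}) := by
    ext ⟨x, y⟩
    constructor
    · rintro ⟨⟨z | z⟩, hz, h⟩
      · obtain rfl : z = x := congrArg Prod.fst h
        obtain rfl : zero = y := congrArg Prod.snd h
        exact Or.inl ⟨hz, rfl⟩
      · obtain rfl : z = y := congrArg Prod.snd h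
        obtain rfl : zero = x := congrArg Prod.fst h
        exact Or.inr ⟨hz, rfl⟩
    · rintro (⟨hz, rfl : y = zero⟩ | ⟨hz, rfl : x = zero⟩)
      exacts [⟨_, hz, rfl⟩, ⟨_, hz, rfl⟩]
  rw [this]
  exact (((hF'.preimage continuous_inl).preimage continuous_fst).inter
    (isClosed_singleton.preimage continuous_snd)).union
    (((hF'.preimage continuous_inr).preimage continuous_snd).inter
    (isClosed_singleton.preimage continuous_fst))

/-- Truncation fixes `zero`, so it preserves each axis. -/
theorem exists_toProd_eq_retr (a : OmegaOne) (x : LongLine) :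
    ∃ y, toProd y = (longExhaustion.prod longExhaustion).retr a (toProd x) := by
  have h0 : min zero (ofOmegaOne a) = zero := min_eq_left (zero_le _)
  obtain ⟨x | x⟩ := x
  · exact ⟨Quot.mk _ (Sum.inl (min x (ofOmegaOne a))), Prod.ext rfl h0.symm⟩
  · exact ⟨Quot.mk _ (Sum.inr (min x (ofOmegaOne a))), Prod.ext h0.symm rfl⟩

/-- The long exhaustion of the Long Line. -/
noncomputable def longExhaustion : LongExhaustion LongLine :=
  (ClosedLongRay.longExhaustion.prod ClosedLongRay.longExhaustion).ofIsClosedEmbedding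
    isClosedEmbedding_toProd fun a x => (exists_toProd_eq_retr a x).choose_spec

instance : T2Space LongLine :=
  isClosedEmbedding_toProd.isEmbedding.t2Space

instance : CompletelyRegularSpace LongLine :=
  isClosedEmbedding_toProd.isInducing.completelyRegularSpace

end LongLine

theorem theoremA {C : Type*} [TopologicalSpace C] [CompactSpace C]
    [TopologicalSpace.MetrizableSpace C] (n m l : ℕ) :
    HasCSHP ((Fin n → LongLine) × (Fin m → ClosedLongRay) × (Fin l → OmegaOne) × C) := by
  have : T35Space ((Fin n → LongLine) × (Fin m → ClosedLongRay) × (Fin l → OmegaOne) × C) :=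
    { toCompletelyRegularSpace := inferInstance, toT0Space := inferInstance }
  exact ((LongLine.longExhaustion.pi _).prod ((ClosedLongRay.longExhaustion.pi _).prod
    ((OmegaOne.longExhaustion.pi _).prod (.ofCompact C)))).hasCSHP
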